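/- Let $k$ be a field and let $\Pi$ be a finite poset. A sheaf on $\Pi$ is an assignment of a finite-dimensional $k$-vector space $F(\pi)$ to each $\pi\in\Pi$ and of a linear map $F(\sigma\le\tau):F(\sigma)\to F(\tau)$ to each relation $\sigma\le\tau$, such that $F(\tau\le\tau)=\mathrm{id}$ and $F(\tau\le\gamma)\circ F(\sigma\le\tau)=F(\sigma\le\gamma)$; morphisms are natural transformations. For $\pi\in\Pi$, the indecomposable injective sheaf $[\pi]$ has $[\pi](\sigma)=k$ if $\sigma\le\pi$ and $[\pi](\sigma)=0$ otherwise, with $[\pi](\sigma\le\tau)=\mathrm{id}$ if $\sigma\le\tau\le\pi$ and $0$ otherwise. The number of indecomposable summands of an injective sheaf $I$ is the number $n$ in an isomorphism $I\cong[\pi_1]\oplus\dots\oplus[\pi_n]$. An injective resolution of a sheaf $F$ is an exact sequence $0\to F\xrightarrow{\alpha}I^0\xrightarrow{\eta^0}I^1\xrightarrow{\eta^1}\cdots$ with every $I^d$ an injective sheaf; it is minimal if, for every injective resolution $J^\bullet$ of $F$ and every $d\ge 0$, the number of indecomposable summands of $I^d$ is at most that of $J^d$. Then every sheaf $F$ on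 $\Pi$ has a minimal injective resolution, and there is one that is bounded, i.e. $I^d=0$ for all sufficiently large $d$. It is unique up to isomorphism of complexes: if $F\xrightarrow{\alpha}I^\bullet$ and $F\xrightarrow{\beta}J^\bullet$ are minimal injective resolutions of $F$, then there is an isomorphism of complexes $e:I^\bullet\to J^\bullet$ with $e^0\circ\alpha=\beta$. -/

import Mathlib

open CategoryTheory CategoryTheory.Limits

universe u v

noncomputable section

/-- Sheaves of finite-dimensional `k`-vector spaces on a poset `P`: a finite-dimensional vector
space `F(σ)` for each `σ`, and linear maps `F(σ ≤ τ) : F(σ) → F(τ)`, functorially in `σ ≤ τ`.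
Morphisms are natural transformations. -/
abbrev PosetSheaf (k : Type u) [Field k] (P : Type v) [PartialOrder P] :=
  P ⥤ FGModuleCat.{u} k

/-- The indecomposable injective sheaf `[π]`. Its value at `σ` is the space of functions to `k`
on the type of proofs of `σ ≤ π`: this is `k` if `σ ≤ π`, and `0` otherwise. The map for `σ ≤ τ`
is restriction of functions along `τ ≤ π → σ ≤ π`: it is the identity of `k` if `σ ≤ τ ≤ π`, and
`0` otherwise. -/
def indecomposableInjectiveSheaf (k : Type u) [Field k] {P : Type v} [PartialOrder P] (π : P) :
    PosetSheaf k P where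
  obj σ := FGModuleCat.of k (PLift (σ ≤ π) → k)
  map {_ τ} f := FGModuleCat.ofHom
    (LinearMap.funLeft k k fun h : PLift (τ ≤ π) => PLift.up ((leOfHom f).trans h.down))
  map_id _ := rfl
  map_comp _ _ := rfl

instance (k : Type u) [Field k] (P : Type v) [PartialOrder P] :
    HasFiniteBiproducts (PosetSheaf k P) :=
  Abelian.hasFiniteBiproducts

/-- `I` is isomorphic to a direct sum `[π₁] ⊕ ⋯ ⊕ [πₙ]` of `n` indecomposable injective
sheaves. -/
def HasIndecomposableSummands {k : Type u} [Field k] {P : Type v} [PartialOrder P]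
    (I : PosetSheaf k P) (n : ℕ) : Prop :=
  ∃ p : Fin n → P, Nonempty (I ≅ ⨁ fun j => indecomposableInjectiveSheaf k (p j))

/-- The number of indecomposable summands of `I`: the number `n` of terms in a decomposition
`I ≅ [π₁] ⊕ ⋯ ⊕ [πₙ]`. It is `⊤` if there is no such decomposition, and the least possible `n`
is taken (although for an injective sheaf on a finite poset a decomposition exists, and all of
them have the same `n`). -/
def numIndecomposableSummands {k : Type u} [Field k] {P : Type v} [PartialOrder P]
    (I : PosetSheaf k P) : ℕ∞ :=
  ⨅ (n : ℕ) (_ : HasIndecomposableSummands I n), (n : ℕ∞)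

/-- An injective resolution `I` of `F` is minimal if, for every injective resolution `J` of `F` and
every `d`, `I^d` has at most as many indecomposable summands as `J^d`. -/
def IsMinimalInjectiveResolution {k : Type u} [Field k] {P : Type v} [PartialOrder P]
    {F : PosetSheaf k P} (I : InjectiveResolution F) : Prop :=
  ∀ (J : InjectiveResolution F) (d : ℕ),
    numIndecomposableSummands (I.cocomplex.X d) ≤ numIndecomposableSummands (J.cocomplex.X d)

end

/-! Everything is read off the socle, the vectors killed by all proper restrictions. On a finite
poset every nonzero vector restricts to a nonzero socle vector, so monomorphisms are detected on
socles (`mono_of_socle`), and the number of summands of an injective sheaf is its total socle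
dimension (`numIndecomposableSummands_eq_socleDim`).

Iterating hulls with the same socle (`exists_injective_hull`) gives a resolution whose differentials
vanish on socles; it stops because each cokernel has smaller support. If the differentials of `I`
vanish on socles, the homotopy from `I ⟶ J ⟶ I` to the identity contributes nothing there. So `I ⟶
J` is injective on socles, and `I` is minimal. Conversely, against such an `I`, a minimal `J` has
equal socle dimensions, so its socles come from `I` and its differentials vanish on them too. Two
such resolutions embed degreewise in each other, hence are isomorphic by dimension. -/

namespace PosetSheaf

/-! ### Socles and detection of monomorphisms -/

section Socle

variable {k : Type u} [Field k] {P : Type v} [PartialOrder P]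

/-- The component at `σ` of a morphism of sheaves, as a linear map. -/
def appLin {F G : PosetSheaf k P} (φ : F ⟶ G) (σ : P) : F.obj σ →ₗ[k] G.obj σ :=
  (φ.app σ).hom.hom

/-- The structure map `F(σ ≤ τ)` of a sheaf, as a linear map. -/
def res (F : PosetSheaf k P) {σ τ : P} (h : σ ≤ τ) : F.obj σ →ₗ[k] F.obj τ :=
  (F.map (homOfLE h)).hom.hom

variable {F G H : PosetSheaf k P}

@[simp]
lemma appLin_id (σ : P) (x : F.obj σ) : appLin (𝟙 F) σ x = x := rfl

@[simp]
lemma appLin_comp (φ : F ⟶ G) (ψ : G ⟶ H) (σ : P) (x : F.obj σ) :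
    appLin (φ ≫ ψ) σ x = appLin ψ σ (appLin φ σ x) := rfl

@[simp]
lemma appLin_zero (σ : P) (x : F.obj σ) : appLin (0 : F ⟶ G) σ x = 0 := rfl

@[simp]
lemma appLin_add (φ ψ : F ⟶ G) (σ : P) (x : F.obj σ) :
    appLin (φ + ψ) σ x = appLin φ σ x + appLin ψ σ x := rfl

lemma appLin_sum {ι : Type*} (s : Finset ι) (φ : ι → (F ⟶ G)) (σ : P) (x : F.obj σ) :
    appLin (∑ j ∈ s, φ j) σ x = ∑ j ∈ s, appLin (φ j) σ x := by
  classical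
  induction s using Finset.induction_on with
  | empty => simp
  | insert a s ha ih => simp [Finset.sum_insert ha, ih]

@[simp]
lemma res_refl (F : PosetSheaf k P) (σ : P) (x : F.obj σ) : res F (le_refl σ) x = x :=
  congrArg (fun f => f.hom.hom x) (F.map_id σ)

@[simp]
lemma res_res (F : PosetSheaf k P) {ρ σ τ : P} (h : ρ ≤ σ) (h' : σ ≤ τ) (x : F.obj ρ) :
    res F h' (res F h x) = res F (h.trans h') x :=
  (congrArg (fun f => f.hom.hom x) (F.map_comp (homOfLE h) (homOfLE h'))).symm

lemma appLin_res (φ : F ⟶ G) {σ τ : P} (h : σ ≤ τ) (x : F.obj σ) :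
    appLin φ τ (res F h x) = res G h (appLin φ σ x) :=
  congrArg (fun f => f.hom.hom x) (φ.naturality (homOfLE h))

lemma hom_ext_appLin {φ ψ : F ⟶ G} (h : ∀ σ x, appLin φ σ x = appLin ψ σ x) : φ = ψ := by
  ext σ : 2
  exact FGModuleCat.hom_ext (LinearMap.ext (h σ))

lemma mono_iff_injective (φ : F ⟶ G) : Mono φ ↔ ∀ σ, Function.Injective (appLin φ σ) := by
  rw [NatTrans.mono_iff_mono_app]
  refine forall_congr' fun σ => ?_
  rw [← Functor.mono_map_iff_mono (forget₂ (FGModuleCat k) (ModuleCat k)), ModuleCat.mono_iff_injective]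
  rfl

lemma surjective_of_epi (φ : F ⟶ G) [Epi φ] (σ : P) : Function.Surjective (appLin φ σ) := by
  have : Epi ((forget₂ (FGModuleCat k) (ModuleCat k)).map (φ.app σ)) := inferInstance
  exact (ModuleCat.epi_iff_surjective _).1 this

lemma isIso_of_bijective (φ : F ⟶ G) (h : ∀ σ, Function.Bijective (appLin φ σ)) : IsIso φ := by
  have : ∀ σ, IsIso (φ.app σ) := fun σ =>
    have : IsIso ((forget₂ (FGModuleCat k) (ModuleCat k)).map (φ.app σ)) :=
      (ConcreteCategory.isIso_iff_bijective _).2 (h σ)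
    isIso_of_reflects_iso _ (forget₂ (FGModuleCat k) (ModuleCat k))
  exact NatIso.isIso_of_isIso_app φ

lemma isZero_of_forall_eq_zero (h : ∀ σ (x : F.obj σ), x = 0) : IsZero F :=
  (IsZero.iff_id_eq_zero F).2 (hom_ext_appLin fun σ x => by rw [h σ x, map_zero, map_zero])

/-- The part at `σ` of the socle of `F`: the vectors of `F(σ)` that are sent to `0` by
`F(σ ≤ τ)` for all `τ > σ`. -/
def socle (F : PosetSheaf k P) (σ : P) : Submodule k (F.obj σ) :=
  ⨅ (τ : P) (h : σ < τ), LinearMap.ker (res F h.le)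

lemma mem_socle {σ : P} {x : F.obj σ} :
    x ∈ socle F σ ↔ ∀ (τ : P) (h : σ < τ), res F h.le x = 0 := by
  simp [socle]

lemma appLin_mem_socle (φ : F ⟶ G) {σ : P} {x : F.obj σ} (hx : x ∈ socle F σ) :
    appLin φ σ x ∈ socle G σ :=
  mem_socle.2 fun τ h => by rw [← appLin_res, mem_socle.1 hx τ h, map_zero]

/-- The map induced on socles by a morphism of sheaves. -/
def socleMap (φ : F ⟶ G) (σ : P) : socle F σ →ₗ[k] socle G σ :=
  (appLin φ σ).restrict fun _ => appLin_mem_socle φ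

/-- Push `x` up to a maximal `τ` at which its restriction is still nonzero. -/
lemma exists_res_mem_socle [Finite P] {σ : P} {x : F.obj σ} (hx : x ≠ 0) :
    ∃ (τ : P) (h : σ ≤ τ), res F h x ∈ socle F τ ∧ res F h x ≠ 0 := by
  obtain ⟨τ, ⟨h, hτ⟩, hmax⟩ := (Set.toFinite {τ : P | ∃ h : σ ≤ τ, res F h x ≠ 0}).exists_maximal
    ⟨σ, le_refl σ, by simpa using hx⟩
  refine ⟨τ, h, mem_socle.2 fun ρ hρ => ?_, hτ⟩
  by_contra hne
  rw [res_res] at hne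
  exact hρ.not_ge (hmax ⟨h.trans hρ.le, hne⟩ hρ.le)

lemma mono_of_socle [Finite P] (φ : F ⟶ G)
    (h : ∀ σ, ∀ x ∈ socle F σ, appLin φ σ x = 0 → x = 0) : Mono φ := by
  refine (mono_iff_injective φ).2 fun σ => (injective_iff_map_eq_zero _).2 fun x hx => ?_
  by_contra hne
  obtain ⟨τ, hτ, hs, hne'⟩ := exists_res_mem_socle hne
  exact hne' (h τ _ hs (by rw [appLin_res, hx, map_zero]))

lemma eq_zero_of_socle_eq_zero [Finite P] {σ : P}
    (h : ∀ τ, σ ≤ τ → ∀ x ∈ socle F τ, x = 0) (x : F.obj σ) : x = 0 := by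
  by_contra hne
  obtain ⟨τ, hτ, hs, hne'⟩ := exists_res_mem_socle hne
  exact hne' (h τ hτ _ hs)

/-- The total dimension of the socle. -/
noncomputable def socleDim [Fintype P] (F : PosetSheaf k P) : ℕ :=
  ∑ σ, Module.finrank k (socle F σ)

lemma socleMap_injective (φ : F ⟶ G) [Mono φ] (σ : P) : Function.Injective (socleMap φ σ) :=
  fun _ _ h => Subtype.ext ((mono_iff_injective φ).1 inferInstance σ (congrArg Subtype.val h))

lemma socleDim_le_of_injective [Fintype P] (φ : F ⟶ G)
    (h : ∀ σ, Function.Injective (socleMap φ σ)) : socleDim F ≤ socleDim G :=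
  Finset.sum_le_sum fun σ _ => LinearMap.finrank_le_finrank_of_injective (h σ)

lemma socleMap_surjective_of_socleDim_eq [Fintype P] (φ : F ⟶ G)
    (h : ∀ σ, Function.Injective (socleMap φ σ)) (hd : socleDim F = socleDim G) (σ : P) :
    Function.Surjective (socleMap φ σ) :=
  (LinearMap.injective_iff_surjective_of_finrank_eq_finrank
    ((Finset.sum_eq_sum_iff_of_le fun τ _ =>
      LinearMap.finrank_le_finrank_of_injective (h τ)).1 hd σ (Finset.mem_univ σ))).1 (h σ)

lemma socleDim_eq_of_iso [Fintype P] (e : F ≅ G) : socleDim F = socleDim G :=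
  le_antisymm (socleDim_le_of_injective e.hom (socleMap_injective e.hom))
    (socleDim_le_of_injective e.inv (socleMap_injective e.inv))

/-- The two injections force equal finite dimensions at each point; `ψ` need not be inverse to `φ`.
-/
lemma isIso_of_mono_of_mono (φ : F ⟶ G) (ψ : G ⟶ F) [Mono φ] [Mono ψ] : IsIso φ := by
  have hφ := (mono_iff_injective φ).1 inferInstance
  have hψ := (mono_iff_injective ψ).1 inferInstance
  refine isIso_of_bijective φ fun σ => ⟨hφ σ, ?_⟩
  exact (LinearMap.injective_iff_surjective_of_finrank_eq_finrank
    (le_antisymm (LinearMap.finrank_le_finrank_of_injective (hφ σ))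
      (LinearMap.finrank_le_finrank_of_injective (hψ σ)))).1 (hφ σ)

end Socle

/-! ### Indecomposable injectives, hulls and counting summands -/

section Injectives

variable {k : Type u} [Field k] {P : Type v} [PartialOrder P] {F G : PosetSheaf k P}

/-- The morphism `F ⟶ [π]` given by a linear functional on `F(π)`. -/
def toIndecomposable {π : P} (φ : F.obj π →ₗ[k] k) :
    F ⟶ indecomposableInjectiveSheaf k π where
  app σ := FGModuleCat.ofHom (LinearMap.pi fun h : PLift (σ ≤ π) => φ ∘ₗ res F h.down)
  naturality σ τ f := by
    refine FGModuleCat.hom_ext (LinearMap.ext fun x => ?_)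
    funext h
    exact congrArg φ (res_res F (leOfHom f) h.down x)

lemma appLin_toIndecomposable {π σ : P} (φ : F.obj π →ₗ[k] k) (x : F.obj σ) (h : σ ≤ π) :
    (show PLift (σ ≤ π) → k from appLin (toIndecomposable φ) σ x) ⟨h⟩ = φ (res F h x) := rfl

lemma appLin_toIndecomposable_self {π : P} (φ : F.obj π →ₗ[k] k) (x : F.obj π)
    (h : appLin (toIndecomposable φ) π x = 0) : φ x = 0 := by
  have := appLin_toIndecomposable φ x le_rfl
  rw [h, res_refl] at this
  exact this.symm

instance (π : P) : Injective (indecomposableInjectiveSheaf k π) where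
  factors {X Y} g f hf := by
    -- A morphism into `[π]` amounts to a functional on the stalk at `π`, so it suffices to extend
    -- one functional along an injection of vector spaces.
    obtain ⟨r, hr⟩ := (appLin f π).exists_leftInverse_of_injective
      (LinearMap.ker_eq_bot.2 ((mono_iff_injective f).1 hf π))
    let φ : X.obj π →ₗ[k] k :=
      LinearMap.proj (R := k) (φ := fun _ : PLift (π ≤ π) => k) ⟨le_rfl⟩ ∘ₗ appLin g π
    refine ⟨toIndecomposable (φ ∘ₗ r), hom_ext_appLin fun σ x => ?_⟩
    funext ⟨h⟩
    change φ (r (res Y h (appLin f σ x))) = _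
    rw [← appLin_res, show r (appLin f π (res X h x)) = res X h x from LinearMap.congr_fun hr _]
    change (show PLift (π ≤ π) → k from appLin g π (res X h x)) ⟨le_rfl⟩ = _
    rw [appLin_res]
    rfl

lemma finrank_socle_indecomposable [DecidableEq P] (π σ : P) :
    Module.finrank k (socle (indecomposableInjectiveSheaf k π) σ) = if σ = π then 1 else 0 := by
  split_ifs with h
  · subst h
    have : socle (indecomposableInjectiveSheaf k σ) σ = ⊤ := by
      refine eq_top_iff.2 fun x _ => mem_socle.2 fun τ hτ => ?_
      funext ⟨h⟩
      exact absurd h hτ.not_ge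
    rw [this, finrank_top]
    change Module.finrank k (PLift (σ ≤ σ) → k) = 1
    have : Unique (PLift (σ ≤ σ)) := ⟨⟨⟨le_rfl⟩⟩, fun _ => rfl⟩
    rw [Module.finrank_fintype_fun_eq_card, Fintype.card_unique]
  · have : socle (indecomposableInjectiveSheaf k π) σ = ⊥ := by
      refine eq_bot_iff.2 fun x hx => ?_
      rw [Submodule.mem_bot]
      funext ⟨hσ⟩
      have := mem_socle.1 hx π (lt_of_le_of_ne hσ h)
      exact congrFun (show (_ : PLift (π ≤ π) → k) = 0 from this) ⟨le_rfl⟩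
    rw [this, finrank_bot]

lemma socleDim_indecomposable [Fintype P] (π : P) :
    socleDim (indecomposableInjectiveSheaf k π) = 1 := by
  classical
  simp [socleDim, finrank_socle_indecomposable]

/-- The socle of a direct sum is the direct sum of the socles. -/
noncomputable def socleBiproductEquiv {n : ℕ} (f : Fin n → PosetSheaf k P) (σ : P) :
    socle (⨁ f) σ ≃ₗ[k] (∀ j, socle (f j) σ) where
  toFun x j := socleMap (biproduct.π f j) σ x
  map_add' x y := by ext; simp
  map_smul' c x := by ext; simp
  invFun x := ∑ j, socleMap (biproduct.ι f j) σ (x j)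
  left_inv x := by
    refine Subtype.ext ?_
    have h := congrArg (fun φ => appLin φ σ x.1) (biproduct.total (f := f))
    rw [appLin_sum, appLin_id] at h
    rw [Submodule.coe_sum]
    exact h
  right_inv x := by
    funext j
    refine Subtype.ext ?_
    dsimp only
    rw [map_sum, Finset.sum_eq_single j]
    · change appLin (biproduct.ι f j ≫ biproduct.π f j) σ (x j).1 = _
      simp
    · intro i _ hi
      refine Subtype.ext ?_
      change appLin (biproduct.ι f i ≫ biproduct.π f j) σ (x i).1 = _
      simp [biproduct.ι_π_ne f hi]
    · simp

lemma socleDim_biproduct [Fintype P] {n : ℕ} (f : Fin n → PosetSheaf k P) :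
    socleDim (⨁ f) = ∑ j, socleDim (f j) := by
  simp only [socleDim]
  rw [Finset.sum_comm]
  refine Finset.sum_congr rfl fun σ _ => ?_
  rw [(socleBiproductEquiv f σ).finrank_eq, Module.finrank_pi_fintype]

lemma socleDim_eq_of_hasIndecomposableSummands [Fintype P] {n : ℕ}
    (h : HasIndecomposableSummands F n) : socleDim F = n := by
  obtain ⟨p, ⟨e⟩⟩ := h
  rw [socleDim_eq_of_iso e, socleDim_biproduct]
  simp [socleDim_indecomposable]

/-- Injective hulls: every sheaf embeds into a direct sum of indecomposable injective sheaves
with the same socle. -/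
lemma exists_injective_hull [Fintype P] (F : PosetSheaf k P) :
    ∃ (I : PosetSheaf k P) (i : F ⟶ I), Injective I ∧ Mono i ∧
      HasIndecomposableSummands I (socleDim F) ∧
        ∀ σ, ∀ y ∈ socle I σ, ∃ x ∈ socle F σ, appLin i σ x = y := by
  -- One summand `[σ]` for each basis vector of the socle at `σ`, mapped to by its coordinate
  -- functional extended to all of `F(σ)`.
  let e : Fin (socleDim F) ≃ Σ σ, Fin (Module.finrank k (socle F σ)) :=
    (Fintype.equivFinOfCardEq (by simp [socleDim])).symm
  choose r hr using fun σ => (socle F σ).subtype.exists_leftInverse_of_injective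
    (Submodule.ker_subtype _)
  let φ (q : Σ σ, Fin (Module.finrank k (socle F σ))) : F.obj q.1 →ₗ[k] k :=
    (Module.finBasis k (socle F q.1)).coord q.2 ∘ₗ r q.1
  let i : F ⟶ ⨁ fun j => indecomposableInjectiveSheaf k (e j).1 :=
    biproduct.lift fun j => toIndecomposable (φ (e j))
  have hφ : ∀ q (x : F.obj q.1), appLin i q.1 x = 0 → φ q x = 0 := by
    intro q x hx
    obtain ⟨j, rfl⟩ := e.surjective q
    refine appLin_toIndecomposable_self _ _ ?_
    have : i ≫ biproduct.π _ j = toIndecomposable (φ (e j)) := biproduct.lift_π _ _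
    rw [← this, appLin_comp, hx, map_zero]
  have hi : Mono i := by
    refine mono_of_socle i fun σ x hx h => ?_
    have hx' : (⟨x, hx⟩ : socle F σ) = 0 := by
      refine (Module.finBasis k (socle F σ)).ext_elem fun j => ?_
      have := hφ ⟨σ, j⟩ x h
      have hrx : r σ x = ⟨x, hx⟩ := LinearMap.congr_fun (hr σ) ⟨x, hx⟩
      simpa [φ, hrx] using this
    exact congrArg Subtype.val hx'
  have hI : HasIndecomposableSummands (⨁ fun j => indecomposableInjectiveSheaf k (e j).1)
      (socleDim F) := ⟨_, ⟨Iso.refl _⟩⟩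
  refine ⟨_, i, inferInstance, hi, hI, fun σ y hy => ?_⟩
  obtain ⟨x, hx⟩ := socleMap_surjective_of_socleDim_eq i (socleMap_injective i)
    (socleDim_eq_of_hasIndecomposableSummands hI).symm σ ⟨y, hy⟩
  exact ⟨x.1, x.2, congrArg Subtype.val hx⟩

/-- The hull of `F` splits, and the retraction is injective because the socle of the hull already
lies in `F`. -/
lemma hasIndecomposableSummands_of_injective [Fintype P] (F : PosetSheaf k P) [Injective F] :
    HasIndecomposableSummands F (socleDim F) := by
  obtain ⟨I, i, _, _, ⟨p, ⟨e⟩⟩, hs⟩ := exists_injective_hull F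
  let r := Injective.factorThru (𝟙 F) i
  have hr : i ≫ r = 𝟙 F := Injective.comp_factorThru _ _
  have : Mono r := by
    refine mono_of_socle r fun σ y hy h => ?_
    obtain ⟨x, -, rfl⟩ := hs σ y hy
    rw [← appLin_comp, hr, appLin_id] at h
    rw [h, map_zero]
  have := isIso_of_mono_of_mono i r
  exact ⟨p, ⟨asIso i ≪≫ e⟩⟩

lemma numIndecomposableSummands_eq_socleDim [Fintype P] (F : PosetSheaf k P) [Injective F] :
    numIndecomposableSummands F = socleDim F :=
  le_antisymm (iInf₂_le _ (hasIndecomposableSummands_of_injective F))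
    (le_iInf₂ fun _ hn => by rw [socleDim_eq_of_hasIndecomposableSummands hn])

end Injectives

end PosetSheaf

/-! ### Building injective resolutions by splicing -/

namespace CategoryTheory.InjectiveResolution

variable {C : Type*} [Category* C] [Abelian C]

/-- The injective resolution given by an exact sequence `0 ⟶ X ⟶ K⁰ ⟶ K¹ ⟶ ⋯` with all `Kⁿ`
injective. -/
noncomputable def ofExact {X : C} (K : CochainComplex C ℕ) (hK : ∀ n, Injective (K.X n))
    (i : X ⟶ K.X 0) (hi : Mono i) (w : i ≫ K.d 0 1 = 0) (h₀ : (ShortComplex.mk i (K.d 0 1) w).Exact)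
    (h : ∀ n, (ShortComplex.mk _ _ (K.d_comp_d n (n + 1) (n + 2))).Exact) :
    InjectiveResolution X where
  cocomplex := K
  ι := (CochainComplex.fromSingle₀Equiv _ _).symm ⟨i, w⟩
  quasiIso := ⟨fun n => by
    cases n with
    | zero =>
      rw [CochainComplex.quasiIsoAt₀_iff, ShortComplex.quasiIso_iff_of_zeros]
      · refine (ShortComplex.exact_and_mono_f_iff_of_iso ?_).2 ⟨h₀, by dsimp; infer_instance⟩
        exact ShortComplex.isoMk (Iso.refl _) (Iso.refl _) (Iso.refl _)
          (by simp; exact (Category.id_comp i).trans (Category.comp_id i).symm)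
          ((Category.id_comp (K.d 0 1)).trans (Category.comp_id (K.d 0 1)).symm)
      · rfl
      · rfl
      · exact K.shape _ _ (by simp)
    | succ n =>
      rw [quasiIsoAt_iff_exactAt _ _ (CochainComplex.exactAt_succ_single_obj _ _),
        HomologicalComplex.exactAt_iff' _ n (n + 1) (n + 1 + 1) (by simp) (by simp)]
      exact h n⟩

/-- The augmentation `X ⟶ I⁰` of an injective resolution of `X`. -/
noncomputable def augmentation {X : C} (R : InjectiveResolution X) : X ⟶ R.cocomplex.X 0 :=
  R.ι.f 0

instance {X : C} (R : InjectiveResolution X) : Mono R.augmentation :=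
  inferInstanceAs (Mono (R.ι.f 0))

lemma augmentation_comp_d {X : C} (R : InjectiveResolution X) :
    R.augmentation ≫ R.cocomplex.d 0 1 = 0 :=
  R.ι_f_zero_comp_complex_d

lemma exact_augmentation {X : C} (R : InjectiveResolution X) :
    (ShortComplex.mk R.augmentation (R.cocomplex.d 0 1) R.augmentation_comp_d).Exact :=
  R.exact₀

/-- The injective resolution of `X` obtained from a short exact sequence `0 ⟶ X ⟶ I ⟶ Y ⟶ 0` with
`I` injective and an injective resolution of `Y`. -/
noncomputable def splice {X I Y : C} (i : X ⟶ I) (p : I ⟶ Y) [Injective I] [Mono i] [Epi p]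
    (w : i ≫ p = 0) (hS : (ShortComplex.mk i p w).Exact) (R : InjectiveResolution Y) :
    InjectiveResolution X :=
  have w' : i ≫ p ≫ R.augmentation = 0 := by rw [reassoc_of% w, zero_comp]
  ofExact (R.cocomplex.augment (p ≫ R.augmentation)
      (by rw [Category.assoc, augmentation_comp_d, comp_zero]))
    (fun n => by
      cases n
      · assumption
      · exact R.injective _)
    i ‹Mono i› w'
    ((ShortComplex.exact_iff_of_epi_of_isIso_of_mono (S₁ := ShortComplex.mk i p w)
      (S₂ := ShortComplex.mk i (p ≫ R.augmentation) w')
      { τ₁ := 𝟙 _, τ₂ := 𝟙 _, τ₃ := R.augmentation }).1 hS)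
    (fun n => by
      cases n with
      | zero =>
        let S₁ := ShortComplex.mk (p ≫ R.augmentation) (R.cocomplex.d 0 1)
          (by rw [Category.assoc, augmentation_comp_d, comp_zero])
        let S₂ := ShortComplex.mk R.augmentation (R.cocomplex.d 0 1) R.augmentation_comp_d
        let f : S₁ ⟶ S₂ := { τ₁ := p, τ₂ := 𝟙 _, τ₃ := 𝟙 _ }
        have : Epi f.τ₁ := inferInstanceAs (Epi p)
        have : IsIso f.τ₂ := inferInstanceAs (IsIso (𝟙 _))
        have : Mono f.τ₃ := inferInstanceAs (Mono (𝟙 _))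
        exact (ShortComplex.exact_iff_of_epi_of_isIso_of_mono f).2 R.exact_augmentation
      | succ n => exact R.exact_succ n)

end CategoryTheory.InjectiveResolution

/-! ### Minimality as vanishing of differentials on socles -/

namespace PosetSheaf

variable {k : Type u} [Field k] {P : Type v} [PartialOrder P] {F : PosetSheaf k P}

/-- The differentials of the resolution vanish on socles. -/
def SocleDifferentialsVanish (I : InjectiveResolution F) : Prop :=
  ∀ (d : ℕ) (σ : P), ∀ x ∈ socle (I.cocomplex.X d) σ, appLin (I.cocomplex.d d (d + 1)) σ x = 0

lemma exists_bounded_resolution [Finite P] (F : PosetSheaf k P) :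
    ∃ I : InjectiveResolution F, SocleDifferentialsVanish I ∧
      ∃ N : ℕ, ∀ d : ℕ, N ≤ d → IsZero (I.cocomplex.X d) := by
  cases nonempty_fintype P
  -- Induct on a lower set containing the support; lowerness makes the hull vanish outside `D` as
  -- well.
  suffices h : ∀ (D : Set P) (_ : IsLowerSet D) (F : PosetSheaf k P)
      (_ : ∀ σ ∉ D, ∀ x : F.obj σ, x = 0), ∃ I : InjectiveResolution F,
        SocleDifferentialsVanish I ∧ ∃ N : ℕ, ∀ d : ℕ, N ≤ d → IsZero (I.cocomplex.X d) from
    h Set.univ isLowerSet_univ F fun σ hσ => absurd (Set.mem_univ σ) hσ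
  intro D
  induction D using WellFoundedLT.induction with
  | ind D ih =>
  intro hD F hF
  rcases D.eq_empty_or_nonempty with rfl | hne
  · have hF0 : IsZero F := isZero_of_forall_eq_zero fun σ x => hF σ (Set.notMem_empty σ) x
    have := hF0.injective
    have h0 : ∀ d, IsZero ((InjectiveResolution.self F).cocomplex.X d) := by
      rintro (_ | d)
      · exact hF0
      · exact HomologicalComplex.isZero_single_obj_X _ _ _ _ (by simp)
    refine ⟨InjectiveResolution.self F, fun d σ x _ => ?_, 0, fun d _ => h0 d⟩
    rw [(h0 d).eq_of_src (HomologicalComplex.d _ d (d + 1)) 0, appLin_zero]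
  · obtain ⟨π, hπ⟩ := D.toFinite.exists_maximal hne
    obtain ⟨I, i, hI, hi, -, hs⟩ := exists_injective_hull F
    have hID : ∀ σ ∉ D, ∀ x : I.obj σ, x = 0 := by
      refine fun σ hσ => eq_zero_of_socle_eq_zero fun τ hτ y hy => ?_
      obtain ⟨x, -, rfl⟩ := hs τ y hy
      rw [hF τ (fun h => hσ (hD hτ h)) x, map_zero]
    have hq : ∀ σ, ∀ y ∈ socle I σ, appLin (cokernel.π i) σ y = 0 := by
      intro σ y hy
      obtain ⟨x, -, rfl⟩ := hs σ y hy
      rw [← appLin_comp, cokernel.condition, appLin_zero]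
    -- At the maximal point `π` all of `I(π)` is socle, hence comes from `F`, so the cokernel
    -- vanishes there.
    obtain ⟨R, hR, N, hN⟩ := ih (D \ {π})
      (Set.sdiff_singleton_ssubset.2 hπ.prop)
      (fun a b hba ha => ⟨hD hba ha.1, fun hb => ha.2 (hπ.eq_of_le ha.1 (hb ▸ hba)).symm⟩)
      (cokernel i) fun σ hσ x => by
        obtain ⟨y, rfl⟩ := surjective_of_epi (cokernel.π i) σ x
        by_cases h : σ ∈ D
        · obtain rfl : σ = π := by
            by_contra hne
            exact hσ ⟨h, hne⟩
          exact hq σ y (mem_socle.2 fun τ hτ => hID τ (fun h' => hπ.not_gt h' hτ) _)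
        · rw [hID σ h y, map_zero]
    refine ⟨InjectiveResolution.splice i (cokernel.π i) (cokernel.condition i)
      (ShortComplex.exact_cokernel i) R, ?_, N + 1, ?_⟩
    · rintro (_ | d) σ x hx
      · exact (congrArg (appLin R.augmentation σ) (hq σ x hx)).trans (map_zero _)
      · exact hR d σ x hx
    · rintro (_ | d) hd
      · omega
      · exact hN d (by omega)

/-- Of the two homotopy terms, one applies the differential of `I` to `x`, the other to the image of
`x` under the homotopy, again a socle vector. Both vanish. -/
lemma homotopyEquiv_inv_hom_apply (I J : InjectiveResolution F) (hI : SocleDifferentialsVanish I)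
    (d : ℕ) (σ : P) (x : I.cocomplex.X d |>.obj σ) (hx : x ∈ socle (I.cocomplex.X d) σ) :
    appLin ((InjectiveResolution.homotopyEquiv I J).inv.f d) σ
      (appLin ((InjectiveResolution.homotopyEquiv I J).hom.f d) σ x) = x := by
  let h := (InjectiveResolution.homotopyEquiv I J).homotopyHomInvId
  rw [← appLin_comp, ← HomologicalComplex.comp_f, h.comm d, appLin_add, appLin_add,
    dNext_eq h.hom (show (ComplexShape.up ℕ).Rel d (d + 1) from rfl), appLin_comp, hI d σ x hx,
    map_zero, zero_add]
  have : appLin (prevD d h.hom) σ x = 0 := by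
    cases d with
    | zero => rw [prevD_eq_zero _ _ (by simp), appLin_zero]
    | succ d =>
      rw [prevD_eq h.hom (show (ComplexShape.up ℕ).Rel d (d + 1) from rfl), appLin_comp]
      exact hI d σ _ (appLin_mem_socle _ hx)
  rw [this, zero_add]
  rfl

lemma socleMap_homotopyEquiv_injective (I J : InjectiveResolution F)
    (hI : SocleDifferentialsVanish I) (d : ℕ) (σ : P) :
    Function.Injective (socleMap ((InjectiveResolution.homotopyEquiv I J).hom.f d) σ) :=
  fun x y hxy => Subtype.ext <| by
    rw [← homotopyEquiv_inv_hom_apply I J hI d σ x.1 x.2,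
      ← homotopyEquiv_inv_hom_apply I J hI d σ y.1 y.2]
    exact congrArg (appLin _ σ) (congrArg Subtype.val hxy)

lemma isMinimal_of_socleDifferentialsVanish [Finite P] (I : InjectiveResolution F)
    (hI : SocleDifferentialsVanish I) : IsMinimalInjectiveResolution I := by
  cases nonempty_fintype P
  intro J d
  rw [numIndecomposableSummands_eq_socleDim, numIndecomposableSummands_eq_socleDim, Nat.cast_le]
  exact socleDim_le_of_injective _ (socleMap_homotopyEquiv_injective I J hI d)

lemma socleDifferentialsVanish_of_isMinimal [Finite P] (J : InjectiveResolution F)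
    (hJ : IsMinimalInjectiveResolution J) : SocleDifferentialsVanish J := by
  cases nonempty_fintype P
  obtain ⟨I, hI, -⟩ := exists_bounded_resolution F
  intro d σ y hy
  have hinj := socleMap_homotopyEquiv_injective I J hI d
  have hle := hJ I d
  rw [numIndecomposableSummands_eq_socleDim, numIndecomposableSummands_eq_socleDim,
    Nat.cast_le] at hle
  obtain ⟨x, hx⟩ := socleMap_surjective_of_socleDim_eq _ hinj
    (le_antisymm (socleDim_le_of_injective _ hinj) hle) σ ⟨y, hy⟩
  obtain rfl : appLin _ σ x.1 = y := congrArg Subtype.val hx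
  -- The chain map carries the vanishing from `x` in `I` to its image `y` in `J`.
  rw [← appLin_comp, HomologicalComplex.Hom.comm, appLin_comp, hI d σ x.1 x.2, map_zero]

lemma mono_homotopyEquiv_hom_f [Finite P] (I J : InjectiveResolution F)
    (hI : SocleDifferentialsVanish I) (d : ℕ) :
    Mono ((InjectiveResolution.homotopyEquiv I J).hom.f d) :=
  mono_of_socle _ fun σ x hx h => by
    rw [← homotopyEquiv_inv_hom_apply I J hI d σ x hx, h, map_zero]

lemma isIso_homotopyEquiv_hom [Finite P] (I J : InjectiveResolution F)
    (hI : SocleDifferentialsVanish I) (hJ : SocleDifferentialsVanish J) :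
    IsIso (InjectiveResolution.homotopyEquiv I J).hom := by
  have : ∀ d, IsIso ((InjectiveResolution.homotopyEquiv I J).hom.f d) := fun d =>
    have := mono_homotopyEquiv_hom_f I J hI d
    have := mono_homotopyEquiv_hom_f J I hJ d
    isIso_of_mono_of_mono _ ((InjectiveResolution.homotopyEquiv J I).hom.f d)
  exact HomologicalComplex.Hom.isIso_of_components _

end PosetSheaf

theorem mainTheorem2 {k : Type u} [Field k] {P : Type v} [PartialOrder P] [Finite P]
    (F : PosetSheaf k P) :
    (∃ I : InjectiveResolution F, IsMinimalInjectiveResolution I ∧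
      ∃ N : ℕ, ∀ d : ℕ, N ≤ d → IsZero (I.cocomplex.X d)) ∧
    (∀ I J : InjectiveResolution F,
      IsMinimalInjectiveResolution I → IsMinimalInjectiveResolution J →
        ∃ e : I.cocomplex ≅ J.cocomplex, I.ι ≫ e.hom = J.ι) := by
  constructor
  · obtain ⟨I, hI, hN⟩ := PosetSheaf.exists_bounded_resolution F
    exact ⟨I, PosetSheaf.isMinimal_of_socleDifferentialsVanish I hI, hN⟩
  · intro I J hI hJ
    have := PosetSheaf.isIso_homotopyEquiv_hom I J
      (PosetSheaf.socleDifferentialsVanish_of_isMinimal I hI)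
      (PosetSheaf.socleDifferentialsVanish_of_isMinimal J hJ)
    exact ⟨asIso (InjectiveResolution.homotopyEquiv I J).hom,
      InjectiveResolution.homotopyEquiv_hom_ι I J⟩
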